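/- Let $H$ be a separable complex Hilbert space with a fixed (countable, finite or infinite) orthonormal basis $(e_i)_{i\in I}$, let $\mathcal B(H)$ be its algebra of bounded operators with the operator norm, $\mathcal K(H)$ the compact operators, $\mathcal U(H)$ the unitary group with the norm topology, and $\mathcal D(\mathcal B(H))=\{T\in\mathcal B(H):\langle Te_i,e_j\rangle=0 \text{ for all } i\neq j\}$ the diagonal operators. For $\mathcal A\subseteq\mathcal B(H)$ write $\mathcal A^{ah}=\{X\in\mathcal A: X^*=-X\}$, and put $$\mathcal U_{k,d}=\{u\in\mathcal U(H): \text{there is } D\in\mathcal D(\mathcal B(H))^{ah}\text{ with } u-e^{D}\in\mathcal K(H)\}.$$ A Lie subgroup of a real Banach--Lie group $G$ is a closed subgroup of $G$ that is itself a real Banach--Lie group with respect to the topology induced by $G$. Theorem. $\mathcal U_{k,d}$ is a Lie subgroup of the Banach--Lie group $\mathcal U(H)$, and its Lie algebra is $$L(\mathcal U_{k,d})=\mathcal K(H)^{ah}+\mathcal D(\mathcal B(H))^{ah}.$$ That is, $\{X\in\mathcal B(H)^{ah}: e^{tX}\in\mathcal U_{k,d}\text{ for all }t\in\mathbb R\}=\mathcal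 K(H)^{ah}+\mathcal D(\mathcal B(H))^{ah}$; moreover $\mathcal U_{k,d}$, with the induced topology, has a Banach--Lie group structure for which the inclusion $\mathcal U_{k,d}\to\mathcal B(H)$ is analytic and its derivative at $1$ is injective with image $\mathcal K(H)^{ah}+\mathcal D(\mathcal B(H))^{ah}$. -/

import Mathlib

open scoped Manifold ContDiff

universe u v

noncomputable section

section LieSubgroups

/-- A topological group `G` is a (real) Banach--Lie group: there are charts of `G`, compatible with
its given topology, in a real Banach space `E` for which `G` is an analytic manifold with analytic
multiplication and inversion. (For Banach--Lie groups, analytic and smooth are equivalent.) -/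
def IsBanachLieGroup (G : Type u) [Group G] [TopologicalSpace G] : Prop :=
  ∃ (E : Type u) (_ : NormedAddCommGroup E) (_ : NormedSpace ℝ E) (_ : CompleteSpace E)
    (_ : ChartedSpace E G), LieGroup 𝓘(ℝ, E) ω G

/-- A Lie subgroup of a Banach--Lie group `G`: a closed subgroup which is itself a Banach--Lie group
with respect to the topology induced by `G`. -/
structure IsLieSubgroup {G : Type u} [Group G] [TopologicalSpace G] (S : Subgroup G) : Prop where
  ambient : IsBanachLieGroup G
  isClosed : IsClosed (S : Set G)
  isBanachLieGroup : IsBanachLieGroup S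

end LieSubgroups

section UnitaryGroup

variable {H : Type u} [NormedAddCommGroup H] [InnerProductSpace ℂ H] [CompleteSpace H]

/-- The set `L(S) = {X ∈ B(H)^{ah} : e^{tX} ∈ S for all real t}` of (generators of) one-parameter
subgroups of a subgroup `S` of the unitary group. -/
def oneParameterLieAlgebra (S : Subgroup (unitary (H →L[ℂ] H))) : Set (H →L[ℂ] H) :=
  {X | star X = -X ∧ ∀ t : ℝ, ∃ u ∈ S, (u : H →L[ℂ] H) = NormedSpace.exp (t • X)}

/-- The subgroup `S` of the unitary group, with the induced topology, is a Banach--Lie group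
analytically immersed in `B(H)`, and the set `L` of operators is its tangent space at `1`, i.e. the
image of the (injective) derivative at `1` of the inclusion of `S` in `B(H)`. -/
def HasTangentLieAlgebra (S : Subgroup (unitary (H →L[ℂ] H))) (L : Set (H →L[ℂ] H)) : Prop :=
  ∃ (E : Type u) (_ : NormedAddCommGroup E) (_ : NormedSpace ℝ E) (_ : CompleteSpace E)
    (_ : ChartedSpace E S),
    LieGroup 𝓘(ℝ, E) ω S ∧
    ContMDiff 𝓘(ℝ, E) 𝓘(ℝ, H →L[ℂ] H) ω (fun u : S => ((u : unitary (H →L[ℂ] H)) : H →L[ℂ] H)) ∧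
    Function.Injective (mfderiv 𝓘(ℝ, E) 𝓘(ℝ, H →L[ℂ] H)
      (fun u : S => ((u : unitary (H →L[ℂ] H)) : H →L[ℂ] H)) 1) ∧
    Set.range (mfderiv 𝓘(ℝ, E) 𝓘(ℝ, H →L[ℂ] H)
      (fun u : S => ((u : unitary (H →L[ℂ] H)) : H →L[ℂ] H)) 1) = L

end UnitaryGroup

section DiagonalPlusCompact

variable {H : Type u} [NormedAddCommGroup H] [InnerProductSpace ℂ H]
  {ι : Type v}

/-- `T` is diagonal with respect to the orthonormal basis `b`. -/
def IsDiagonalOp (b : HilbertBasis ι ℂ H) (T : H →L[ℂ] H) : Prop :=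
  ∀ i j, i ≠ j → inner ℂ (T (b i)) (b j) = 0

theorem IsDiagonalOp.apply_basis {b : HilbertBasis ι ℂ H} {T : H →L[ℂ] H}
    (hT : IsDiagonalOp b T) (i : ι) : ∃ c : ℂ, T (b i) = c • b i := by
  classical
  refine ⟨inner ℂ (b i) (T (b i)), ?_⟩
  apply b.repr.injective
  ext j
  rw [b.repr_apply_apply, b.repr_apply_apply, inner_smul_right,
    orthonormal_iff_ite.mp b.orthonormal j i]
  by_cases h : j = i
  · subst h; simp
  · have h2 := hT i j (Ne.symm h)
    rw [← inner_conj_symm, h2]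
    simp [h]

theorem IsDiagonalOp.commute {b : HilbertBasis ι ℂ H} {S T : H →L[ℂ] H}
    (hS : IsDiagonalOp b S) (hT : IsDiagonalOp b T) : Commute S T := by
  refine ContinuousLinearMap.ext_on (s := Set.range b) ?_ ?_
  · rw [Submodule.dense_iff_topologicalClosure_eq_top]
    exact b.dense_span
  · rintro _ ⟨i, rfl⟩
    obtain ⟨c, hc⟩ := hS.apply_basis i
    obtain ⟨d, hd⟩ := hT.apply_basis i
    simp [hc, hd, smul_smul, mul_comm]

theorem IsDiagonalOp.zero (b : HilbertBasis ι ℂ H) : IsDiagonalOp b 0 := by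
  intro i j _
  simp

theorem IsDiagonalOp.add {b : HilbertBasis ι ℂ H} {S T : H →L[ℂ] H}
    (hS : IsDiagonalOp b S) (hT : IsDiagonalOp b T) : IsDiagonalOp b (S + T) := by
  intro i j h
  simp [hS i j h, hT i j h]

theorem IsDiagonalOp.neg {b : HilbertBasis ι ℂ H} {T : H →L[ℂ] H}
    (hT : IsDiagonalOp b T) : IsDiagonalOp b (-T) := by
  intro i j h
  simp [inner_neg_left, hT i j h]

theorem IsDiagonalOp.real_smul {b : HilbertBasis ι ℂ H} {T : H →L[ℂ] H}
    (c : ℝ) (hT : IsDiagonalOp b T) : IsDiagonalOp b (c • T) := by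
  intro i j h
  have : (c • T) (b i) = (c : ℂ) • T (b i) := rfl
  simp [this, hT i j h]

theorem IsCompactOperator.mul_left_clm {T : H →L[ℂ] H} (hT : IsCompactOperator T)
    (S : H →L[ℂ] H) : IsCompactOperator (S * T) :=
  hT.clm_comp S

theorem IsCompactOperator.mul_right_clm {T : H →L[ℂ] H} (hT : IsCompactOperator T)
    (S : H →L[ℂ] H) : IsCompactOperator (T * S) :=
  hT.comp_clm S

variable [CompleteSpace H]

/-- The subgroup `U_{k,d}` of the unitary operators `u` such that `u - e^D` is compact for some
anti-Hermitian bounded operator `D` which is diagonal with respect to the basis `b`. -/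
def unitaryKD (b : HilbertBasis ι ℂ H) : Subgroup (unitary (H →L[ℂ] H)) where
  carrier := {u | ∃ D : H →L[ℂ] H, IsDiagonalOp b D ∧ star D = -D ∧
    IsCompactOperator ((u : H →L[ℂ] H) - NormedSpace.exp D)}
  one_mem' := ⟨0, .zero b, by simp, by simpa using isCompactOperator_zero⟩
  mul_mem' := by
    rintro u w ⟨D, hD, hDs, hDc⟩ ⟨D', hD', hDs', hDc'⟩
    refine ⟨D + D', hD.add hD', by rw [star_add, hDs, hDs']; abel, ?_⟩
    let +nondep : NormedAlgebra ℚ (H →L[ℂ] H) := .restrictScalars ℚ ℂ (H →L[ℂ] H)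
    have h : ((u * w : unitary (H →L[ℂ] H)) : H →L[ℂ] H) - NormedSpace.exp (D + D')
        = ((u : H →L[ℂ] H) - NormedSpace.exp D) * (w : H →L[ℂ] H)
          + NormedSpace.exp D * ((w : H →L[ℂ] H) - NormedSpace.exp D') := by
      rw [NormedSpace.exp_add_of_commute (hD.commute hD'), Submonoid.coe_mul]
      noncomm_ring
    rw [h]
    exact (hDc.mul_right_clm _).add (hDc'.mul_left_clm _)
  inv_mem' := by
    rintro u ⟨D, hD, hDs, hDc⟩
    refine ⟨-D, hD.neg, by rw [star_neg, hDs], ?_⟩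
    let +nondep : NormedAlgebra ℚ (H →L[ℂ] H) := .restrictScalars ℚ ℂ (H →L[ℂ] H)
    have h1 : ((u⁻¹ : unitary (H →L[ℂ] H)) : H →L[ℂ] H) * (u : H →L[ℂ] H) = 1 := by
      rw [← Submonoid.coe_mul, inv_mul_cancel, Submonoid.coe_one]
    have h2 : NormedSpace.exp D * NormedSpace.exp (-D) = 1 := by
      rw [← NormedSpace.exp_add_of_commute (Commute.neg_right (Commute.refl D))]
      simp
    have h : ((u⁻¹ : unitary (H →L[ℂ] H)) : H →L[ℂ] H) - NormedSpace.exp (-D)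
        = -(((u⁻¹ : unitary (H →L[ℂ] H)) : H →L[ℂ] H)
            * (((u : H →L[ℂ] H) - NormedSpace.exp D) * NormedSpace.exp (-D))) := by
      rw [sub_mul, h2, mul_sub, ← mul_assoc, h1]
      simp
    rw [h]
    exact ((hDc.mul_right_clm _).mul_left_clm _).neg

attribute [local instance] LieRing.ofAssociativeRing

/-- The real Lie algebra `K(H)^{ah} + D(B(H))^{ah}` of sums of a compact anti-Hermitian operator and
a bounded anti-Hermitian operator which is diagonal with respect to `b`, with the commutator as
bracket. -/
def lieAlgebraKD (b : HilbertBasis ι ℂ H) : LieSubalgebra ℝ (H →L[ℂ] H) where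
  carrier := {X | ∃ K D : H →L[ℂ] H, (IsCompactOperator K ∧ star K = -K) ∧
    (IsDiagonalOp b D ∧ star D = -D) ∧ X = K + D}
  zero_mem' := ⟨0, 0, ⟨isCompactOperator_zero, by simp⟩, ⟨.zero b, by simp⟩, by simp⟩
  add_mem' := by
    rintro _ _ ⟨K, D, ⟨hK, hKs⟩, ⟨hD, hDs⟩, rfl⟩ ⟨K', D', ⟨hK', hKs'⟩, ⟨hD', hDs'⟩, rfl⟩
    exact ⟨K + K', D + D', ⟨hK.add hK', by rw [star_add, hKs, hKs']; abel⟩,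
      ⟨hD.add hD', by rw [star_add, hDs, hDs']; abel⟩, by abel⟩
  smul_mem' := by
    rintro c _ ⟨K, D, ⟨hK, hKs⟩, ⟨hD, hDs⟩, rfl⟩
    exact ⟨c • K, c • D, ⟨hK.smul c, by rw [star_smul, hKs]; simp⟩,
      ⟨hD.real_smul c, by rw [star_smul, hDs]; simp⟩, by rw [smul_add]⟩
  lie_mem' := by
    rintro _ _ ⟨K, D, ⟨hK, hKs⟩, ⟨hD, hDs⟩, rfl⟩ ⟨K', D', ⟨hK', hKs'⟩, ⟨hD', hDs'⟩, rfl⟩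
    have hc : D * D' = D' * D := (hD.commute hD').eq
    have hE : ⁅K + D, K' + D'⁆
        = (K * (K' + D') + D * K') - (K' * (K + D) + D' * K) := by
      rw [Ring.lie_def]
      simp only [add_mul, mul_add, hc]
      abel
    refine ⟨⁅K + D, K' + D'⁆, 0, ⟨?_, ?_⟩, ⟨.zero b, by simp⟩, by simp⟩
    · rw [hE]
      exact ((hK.mul_right_clm _).add (hK'.mul_left_clm _)).sub
        ((hK'.mul_right_clm _).add (hK.mul_left_clm _))
    · rw [Ring.lie_def, star_sub, star_mul, star_mul, star_add, star_add, hKs, hKs', hDs, hDs']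
      noncomm_ring

end DiagonalPlusCompact

end

/-! The group `unitaryKD b` is the unitary group of one C⋆-algebra, the algebra `diagCompact b` of
compact plus diagonal operators; everything else follows from general facts about C⋆-algebras.

This sum is norm closed because taking the diagonal part `E` is bounded and sends compact operators
to compact ones, so `T` lies in it iff `T - E T` is compact
(`mem_diagCompact_iff_isCompactOperator_sub`). If `u = K + D` is unitary, then `star D * D - 1` is
compact, so the eigenvalues of `D` have moduli tending to 1. Replacing them by their phases changes
`D` by a compact operator and produces `e^{D'}` with `D'` diagonal and skew (`mem_unitaryKD_iff`).

For any C⋆-algebra, the Cayley transform identifies the open set of unitaries `a` with `a + 1`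
invertible with the Banach space of skew-adjoint elements. Its left translates form an analytic
atlas, and the tangent space at 1 is the space of skew-adjoint elements (`lieGroup_cayley`,
`hasMFDerivAt_unitaryEmb_one`). Splitting a skew element of `diagCompact b` into skew compact and
skew diagonal parts gives the stated Lie algebra. One-parameter groups are handled by
differentiating at 0, and conversely by the exponential series, inside a closed algebra. -/

noncomputable section

/-! ### The Cayley transform in a C⋆-algebra -/

section CayleyTransform

theorem Commute.ringInverse_right' {M : Type*} [MonoidWithZero M] {a b : M} (h : Commute a b) :
    Commute a (Ring.inverse b) := by
  by_cases hb : IsUnit b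
  · obtain ⟨v, rfl⟩ := hb
    rw [Ring.inverse_unit]
    exact h.units_inv_right
  · rw [Ring.inverse_non_unit _ hb]
    exact Commute.zero_right a

variable (A : Type u) [CStarAlgebra A]

/-- The real Banach space of skew-adjoint elements of a C⋆-algebra. -/
abbrev SkewSpace : Type u := skewAdjoint.submodule ℝ A

variable {A}

theorem mem_skewSpace_iff {x : A} : x ∈ skewAdjoint.submodule ℝ A ↔ star x = -x := Iff.rfl

theorem SkewSpace.star_coe (x : SkewSpace A) : star (x : A) = -x := x.2

instance : CompleteSpace (SkewSpace A) := by
  have h : IsClosed ((skewAdjoint.submodule ℝ A : Submodule ℝ A) : Set A) :=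
    isClosed_eq continuous_star continuous_neg
  exact h.completeSpace_coe

/-- The skew-adjoint part of an element, as a continuous real-linear map. -/
def skewPart : A →L[ℝ] SkewSpace A :=
  ((2⁻¹ : ℝ) • (ContinuousLinearMap.id ℝ A - (starL' ℝ : A ≃L[ℝ] A).toContinuousLinearMap)).codRestrict
    (skewAdjoint.submodule ℝ A) fun x => by
      rw [mem_skewSpace_iff]
      simp [← smul_neg]

theorem skewPart_apply (x : A) : (skewPart x : A) = (2⁻¹ : ℝ) • (x - star x) := by
  simp [skewPart]

theorem skewPart_of_star_eq_neg {x : A} (hx : star x = -x) : (skewPart x : A) = x := by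
  rw [skewPart_apply, hx, sub_neg_eq_add, ← two_smul ℝ, smul_smul]
  norm_num

/-- Since `i x` is self-adjoint, its spectrum is real; `1` in the spectrum of `x` would put `i` in
that of `i x`. -/
theorem isUnit_one_sub_of_star_eq_neg {x : A} (hx : star x = -x) : IsUnit (1 - x) := by
  have hs : IsSelfAdjoint (Complex.I • x) := by
    rw [IsSelfAdjoint, star_smul, hx]; simp
  by_contra h
  have h1 : (1 : ℂ) ∈ spectrum ℂ x := by
    rwa [spectrum.mem_iff, map_one]
  have h2 : Complex.I * 1 ∈ spectrum ℂ (Complex.I • x) := by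
    rw [← smul_eq_mul]
    have := (spectrum.unit_smul_eq_smul x (Units.mk0 Complex.I Complex.I_ne_zero))
    simp only [Units.smul_def, Units.val_mk0] at this
    rw [this]
    exact Set.smul_mem_smul_set h1
  have := hs.mem_spectrum_eq_re h2
  simpa using congrArg Complex.im this

theorem isUnit_one_add_of_star_eq_neg {x : A} (hx : star x = -x) : IsUnit (1 + x) := by
  have := isUnit_one_sub_of_star_eq_neg (x := -x) (by rw [star_neg, hx])
  rwa [sub_neg_eq_add] at this

/-- The inverse Cayley transform `x ↦ (1 + x) (1 - x)⁻¹`. -/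
def invCayley (x : SkewSpace A) : A := (1 + (x : A)) * Ring.inverse (1 - (x : A))

/-- The Cayley transform `a ↦ (a - 1) (a + 1)⁻¹`, followed by the projection on the skew-adjoint
elements. -/
def cayley (a : A) : SkewSpace A := skewPart ((a - 1) * Ring.inverse (a + 1))

theorem invCayley_mul (x : SkewSpace A) : invCayley x * (1 - (x : A)) = 1 + x := by
  rw [invCayley, mul_assoc, Ring.inverse_mul_cancel _ (isUnit_one_sub_of_star_eq_neg x.2), mul_one]

/-- The star exchanges `1 - x` and `1 + x`, and these two units commute. -/
theorem invCayley_mem_unitary (x : SkewSpace A) : invCayley x ∈ unitary A := by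
  obtain ⟨v, hv⟩ := isUnit_one_sub_of_star_eq_neg x.2
  obtain ⟨w, hw⟩ := isUnit_one_add_of_star_eq_neg x.2
  have hsv : star (v : A) = w := by rw [hv, hw, star_sub, star_one, x.star_coe]; simp
  have hsv' : star v = w := Units.ext hsv
  have hsw' : star w = v := by rw [← hsv', star_star]
  have hc : Commute v w := by
    rw [Commute, SemiconjBy, Units.ext_iff, Units.val_mul, Units.val_mul, hv, hw]; noncomm_ring
  have h : invCayley x = ((w * v⁻¹ : Aˣ) : A) := by
    rw [invCayley, ← hv, ← hw, Ring.inverse_unit, Units.val_mul]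
  rw [Unitary.mem_iff, h, ← Units.coe_star, ← Units.val_mul, ← Units.val_mul, star_mul, star_inv,
    hsv', hsw']
  constructor
  · rw [Units.val_eq_one, mul_assoc, ← mul_assoc v w, hc.eq]; group
  · rw [Units.val_eq_one, mul_assoc, ← mul_assoc v⁻¹ w⁻¹, ← mul_inv_rev, ← hc.eq]; group

/-- The identity `(invCayley x + 1) (1 - x) = 2` exhibits the inverse. Hence the chart has the whole
model space as target. -/
theorem isUnit_invCayley_add_one (x : SkewSpace A) : IsUnit (invCayley x + 1) := by
  have h2 : IsUnit ((2 : ℂ) • (1 : A)) := by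
    have : IsUnit (algebraMap ℂ A 2) := (IsUnit.mk0 (2 : ℂ) two_ne_zero).map _
    rwa [Algebra.algebraMap_eq_smul_one] at this
  have hu := isUnit_one_sub_of_star_eq_neg x.2
  have h : (invCayley x + 1) * (1 - (x : A)) = (2 : ℂ) • (1 : A) := by
    rw [add_mul, invCayley_mul, two_smul, one_mul]; abel
  have h3 : invCayley x + 1 = ((2 : ℂ) • (1 : A)) * Ring.inverse (1 - (x : A)) := by
    rw [← h, mul_assoc, Ring.mul_inverse_cancel _ hu, mul_one]
  rw [h3]
  exact h2.mul (isUnit_ringInverse.mpr hu)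

theorem cayley_invCayley (x : SkewSpace A) : cayley (invCayley x) = x := by
  have h : (invCayley x - 1) * Ring.inverse (invCayley x + 1) = x := by
    have hu := isUnit_invCayley_add_one x
    have h1 := invCayley_mul x
    have hc : (x : A) * invCayley x = invCayley x * x := by
      have hx : Commute (x : A) (1 - x) := (Commute.one_right _).sub_right (Commute.refl _)
      have hx' : Commute (x : A) (1 + x) := (Commute.one_right _).add_right (Commute.refl _)
      exact Commute.mul_right hx' (Commute.ringInverse_right' hx)
    have h2 : invCayley x - 1 = x * (invCayley x + 1) := by
      rw [mul_sub, mul_one] at h1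
      rw [mul_add, hc, mul_one]
      linear_combination (norm := noncomm_ring) h1
    rw [h2, mul_assoc, Ring.mul_inverse_cancel _ hu, mul_one]
  apply Subtype.ext
  rw [cayley, h, skewPart_of_star_eq_neg x.2]

theorem invCayley_cayley {a : A} (ha : a ∈ unitary A) (hu : IsUnit (a + 1)) :
    invCayley (cayley a) = a := by
  obtain ⟨w, hw⟩ := hu
  have hss := Unitary.star_mul_self_of_mem ha
  have hss' := Unitary.mul_star_self_of_mem ha
  set y : A := (a - 1) * Ring.inverse (a + 1) with hy
  have hya : y * (a + 1) = a - 1 := by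
    rw [hy, ← hw, Ring.inverse_unit, mul_assoc, Units.inv_mul, mul_one]
  have hay : (a + 1) * y = a - 1 := by
    have hc : Commute (a + 1) (a - 1) := by
      rw [Commute, SemiconjBy]; noncomm_ring
    have h2 : Commute (a + 1) y := hc.mul_right (Commute.ringInverse_right' (Commute.refl (a + 1)))
    rw [h2.eq, hya]
  have hskew : star y = -y := by
    have h1 : star y * (star a + 1) = star a - 1 := by
      have := congrArg star hay
      simpa using this
    -- Right multiplication of `h1` by `a`, with `star a * a = 1`; comparison with `hya` then forces
    -- `star y = -y`.
    have h2 : star y * (a + 1) = 1 - a := by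
      have := congrArg (· * a) h1
      simp only [mul_assoc, add_mul, sub_mul, one_mul, hss] at this
      rw [add_comm 1 a] at this
      exact this
    have h3 : (star y + y) * (a + 1) = 0 := by rw [add_mul, h2, hya]; abel
    rw [← hw] at h3
    exact eq_neg_of_add_eq_zero_left ((Units.mul_left_eq_zero w).mp h3)
  have hcoe : ((cayley a : SkewSpace A) : A) = y := by
    rw [cayley, ← hy, skewPart_of_star_eq_neg hskew]
  obtain ⟨v, hv⟩ := isUnit_one_sub_of_star_eq_neg hskew
  rw [invCayley, hcoe]
  have h4 : a * (1 - y) = 1 + y := by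
    rw [add_mul, one_mul] at hay
    rw [mul_sub, mul_one]
    linear_combination (norm := noncomm_ring) -hay
  rw [← h4, mul_assoc, ← hv, Ring.mul_inverse_cancel _ v.isUnit, mul_one]

theorem contDiff_invCayley {n : ℕ∞ω} : ContDiff ℝ n (invCayley : SkewSpace A → A) := by
  have hsub : ContDiff ℝ n (fun x : SkewSpace A => (x : A)) :=
    (skewAdjoint.submodule ℝ A).subtypeL.contDiff
  refine (contDiff_const.add hsub).mul (contDiff_iff_contDiffAt.mpr fun x => ?_)
  obtain ⟨v, hv⟩ := isUnit_one_sub_of_star_eq_neg x.2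
  have h := contDiffAt_ringInverse (n := n) ℝ v
  rw [hv] at h
  exact ContDiffAt.comp (g := Ring.inverse) x h (contDiff_const.sub hsub).contDiffAt

theorem contDiffAt_cayley {n : ℕ∞ω} {a : A} (ha : IsUnit (a + 1)) :
    ContDiffAt ℝ n (cayley : A → SkewSpace A) a := by
  refine skewPart.contDiff.contDiffAt.comp a
    ((contDiff_id.sub contDiff_const).contDiffAt.mul ?_)
  obtain ⟨v, hv⟩ := ha
  have h := contDiffAt_ringInverse (n := n) ℝ v
  rw [hv] at h
  exact ContDiffAt.comp (g := Ring.inverse) a h (contDiff_id.add contDiff_const).contDiffAt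

theorem cayley_one : cayley (1 : A) = 0 := by simp [cayley]

theorem invCayley_zero : invCayley (0 : SkewSpace A) = 1 := by simp [invCayley]

/-- To first order `(1 + x)(1 - x)⁻¹ = 1 + 2x`; this is the origin of the factor 2 below. -/
theorem hasFDerivAt_invCayley_zero :
    HasFDerivAt (invCayley : SkewSpace A → A)
      ((2 : ℝ) • (skewAdjoint.submodule ℝ A).subtypeL) 0 := by
  have hsub : HasFDerivAt (fun x : SkewSpace A => (x : A))
    (skewAdjoint.submodule ℝ A).subtypeL 0 := (skewAdjoint.submodule ℝ A).subtypeL.hasFDerivAt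
  have h := hasFDerivAt_ringInverse (𝕜 := ℝ) (1 : Aˣ)
  have h0 : ((1 : Aˣ) : A) = 1 - ((0 : SkewSpace A) : A) := by simp
  rw [h0] at h
  have h1 := h.comp (0 : SkewSpace A) (hsub.const_sub 1)
  refine ((hsub.const_add 1).mul' h1).congr_fderiv ?_
  ext x
  simp [two_smul]

end CayleyTransform

/-! ### The Banach–Lie group structure on a unitary group -/

section UnitaryLieGroup

variable {A : Type u} [CStarAlgebra A] {G : Type u} [Group G] [TopologicalSpace G]
  (e : G ≃ₜ* unitary A)

/-- The embedding in `A` of a topological group which is isomorphic to the unitary group of `A`. -/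
def unitaryEmb (g : G) : A := (e g : A)

theorem unitaryEmb_mul (g h : G) : unitaryEmb e (g * h) = unitaryEmb e g * unitaryEmb e h := by
  simp [unitaryEmb]

theorem unitaryEmb_inv (g : G) : unitaryEmb e g⁻¹ = star (unitaryEmb e g) := by
  rw [unitaryEmb, map_inv]
  rfl

theorem unitaryEmb_one : unitaryEmb e 1 = 1 := by simp [unitaryEmb]

theorem continuous_unitaryEmb : Continuous (unitaryEmb e) :=
  continuous_subtype_val.comp e.continuous

variable [IsTopologicalGroup G]

/-- The Cayley chart around a point `g`. -/
def cayleyChart (g : G) : OpenPartialHomeomorph G (SkewSpace A) where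
  toFun x := cayley (unitaryEmb e (g⁻¹ * x))
  invFun x := g * e.symm ⟨invCayley x, invCayley_mem_unitary x⟩
  source := {x | IsUnit (unitaryEmb e (g⁻¹ * x) + 1)}
  target := Set.univ
  map_source' _ _ := Set.mem_univ _
  map_target' x _ := by
    rw [Set.mem_ofPred_eq, inv_mul_cancel_left]
    simpa [unitaryEmb] using isUnit_invCayley_add_one x
  left_inv' x hx := by
    have h : e.symm ⟨invCayley (cayley (unitaryEmb e (g⁻¹ * x))), invCayley_mem_unitary _⟩
        = g⁻¹ * x := by
      rw [ContinuousMulEquiv.symm_apply_eq]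
      exact Subtype.ext (invCayley_cayley (e (g⁻¹ * x)).2 hx)
    rw [h, mul_inv_cancel_left]
  right_inv' x _ := by
    rw [inv_mul_cancel_left]
    simpa [unitaryEmb] using cayley_invCayley x
  open_source := by
    refine Units.isOpen.preimage (f := fun x => unitaryEmb e (g⁻¹ * x) + 1) ?_
    exact ((continuous_unitaryEmb e).comp (continuous_const_mul g⁻¹)).add continuous_const
  open_target := isOpen_univ
  continuousOn_toFun := fun x hx => by
    refine ContinuousAt.continuousWithinAt ?_
    exact ContinuousAt.comp (f := fun x => unitaryEmb e (g⁻¹ * x)) (g := cayley)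
      (contDiffAt_cayley (n := 0) hx).continuousAt
      ((continuous_unitaryEmb e).comp (continuous_const_mul g⁻¹)).continuousAt
  continuousOn_invFun := by
    refine Continuous.continuousOn (continuous_const.mul (e.symm.continuous.comp ?_))
    exact (contDiff_invCayley (n := 0)).continuous.subtype_mk _

theorem unitaryEmb_cayleyChart_symm (g : G) (x : SkewSpace A) :
    unitaryEmb e ((cayleyChart e g).symm x) = unitaryEmb e g * invCayley x := by
  change unitaryEmb e (g * e.symm ⟨invCayley x, invCayley_mem_unitary x⟩) = _
  rw [unitaryEmb_mul]
  simp [unitaryEmb]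

theorem cayleyChart_apply (g x : G) :
    cayleyChart e g x = cayley (unitaryEmb e g⁻¹ * unitaryEmb e x) := by
  change cayley (unitaryEmb e (g⁻¹ * x)) = _
  rw [unitaryEmb_mul]

theorem mem_cayleyChart_source {g x : G} :
    x ∈ (cayleyChart e g).source ↔ IsUnit (unitaryEmb e g⁻¹ * unitaryEmb e x + 1) := by
  change IsUnit (unitaryEmb e (g⁻¹ * x) + 1) ↔ _
  rw [unitaryEmb_mul]

theorem mem_cayleyChart_source_self (g : G) : g ∈ (cayleyChart e g).source := by
  rw [mem_cayleyChart_source, ← unitaryEmb_mul, inv_mul_cancel, unitaryEmb_one]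
  simpa [invCayley_zero] using isUnit_invCayley_add_one (0 : SkewSpace A)

/-- The atlas of Cayley charts. -/
abbrev cayleyChartedSpace : ChartedSpace (SkewSpace A) G where
  atlas := Set.range (cayleyChart e)
  chartAt := cayleyChart e
  mem_chart_source := mem_cayleyChart_source_self e
  chart_mem_atlas g := ⟨g, rfl⟩

/-- A change of charts is `cayley` after multiplication by a fixed element after `invCayley`, and
each factor is analytic between open sets of Banach spaces. -/
theorem isManifold_cayley :
    letI := cayleyChartedSpace e
    IsManifold 𝓘(ℝ, SkewSpace A) ω G := by
  let := cayleyChartedSpace e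
  refine isManifold_of_contDiffOn _ _ _ ?_
  rintro _ _ ⟨g, rfl⟩ ⟨h, rfl⟩ x hx
  have hx' : (cayleyChart e g).symm x ∈ (cayleyChart e h).source := by
    exact hx.1.2
  rw [mem_cayleyChart_source, unitaryEmb_cayleyChart_symm] at hx'
  have hf : ∀ y : SkewSpace A, cayleyChart e h ((cayleyChart e g).symm y)
      = cayley (unitaryEmb e h⁻¹ * (unitaryEmb e g * invCayley y)) := fun y => by
    rw [cayleyChart_apply, unitaryEmb_cayleyChart_symm]
  refine ContDiffAt.contDiffWithinAt ?_
  have hc : ContDiffAt ℝ ω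
      (fun y : SkewSpace A => cayley (unitaryEmb e h⁻¹ * (unitaryEmb e g * invCayley y))) x :=
    ContDiffAt.comp (g := cayley) x (contDiffAt_cayley hx')
      (contDiff_const.mul (contDiff_const.mul contDiff_invCayley)).contDiffAt
  exact hc.congr_of_eventuallyEq (Filter.Eventually.of_forall fun y => hf y)

theorem contMDiff_unitaryEmb :
    letI := cayleyChartedSpace e
    ContMDiff 𝓘(ℝ, SkewSpace A) 𝓘(ℝ, A) ω (unitaryEmb e) := by
  let := cayleyChartedSpace e
  have := isManifold_cayley e
  rw [contMDiff_iff]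
  refine ⟨continuous_unitaryEmb e, fun g a => ?_⟩
  have hf : ∀ y : SkewSpace A, unitaryEmb e ((cayleyChart e g).symm y)
      = unitaryEmb e g * invCayley y := fun y => unitaryEmb_cayleyChart_symm e g y
  have hc : ContDiff ℝ ω (fun y : SkewSpace A => unitaryEmb e g * invCayley y) :=
    contDiff_const.mul contDiff_invCayley
  exact hc.contDiffOn.congr fun y _ => hf y

section

variable {E' H' M : Type*} [NormedAddCommGroup E'] [NormedSpace ℝ E'] [TopologicalSpace H']
  {I : ModelWithCorners ℝ E' H'} [TopologicalSpace M] [ChartedSpace H' M]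

/-- Each chart is the restriction of a map analytic on an open subset of `A`, so analyticity into
`G` can be tested in `A`. There the group operations become a bilinear and a linear map. -/
theorem contMDiff_of_unitaryEmb_comp {φ : M → G} (hφ : Continuous φ)
    (h : ContMDiff I 𝓘(ℝ, A) ω (unitaryEmb e ∘ φ)) :
    letI := cayleyChartedSpace e
    ContMDiff I 𝓘(ℝ, SkewSpace A) ω φ := by
  let := cayleyChartedSpace e
  intro x
  rw [contMDiffAt_iff_target]
  refine ⟨hφ.continuousAt, ?_⟩
  have hf : (extChartAt 𝓘(ℝ, SkewSpace A) (φ x) ∘ φ)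
      = fun y => cayley (unitaryEmb e (φ x)⁻¹ * (unitaryEmb e ∘ φ) y) := by
    ext1 y
    exact cayleyChart_apply e (φ x) (φ y)
  have hs := mem_cayleyChart_source_self e (φ x)
  rw [mem_cayleyChart_source] at hs
  rw [hf]
  have hc : ContDiffAt ℝ ω (fun a : A => cayley (unitaryEmb e (φ x)⁻¹ * a))
      ((unitaryEmb e ∘ φ) x) :=
    ContDiffAt.comp (g := cayley) _ (contDiffAt_cayley hs)
      (contDiff_const.mul contDiff_id).contDiffAt
  exact hc.contMDiffAt.comp x (h x)

end

theorem lieGroup_cayley :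
    letI := cayleyChartedSpace e
    LieGroup 𝓘(ℝ, SkewSpace A) ω G := by
  let := cayleyChartedSpace e
  have := isManifold_cayley e
  have hf := contMDiff_unitaryEmb e
  refine { contMDiff_mul := ?_, contMDiff_inv := ?_ }
  · refine contMDiff_of_unitaryEmb_comp e continuous_mul ?_
    have h : unitaryEmb e ∘ (fun p : G × G => p.1 * p.2)
        = fun p => unitaryEmb e p.1 * unitaryEmb e p.2 := by
      ext1 p
      exact unitaryEmb_mul e p.1 p.2
    rw [h]
    exact (contDiff_mul (𝕜 := ℝ) (𝔸 := A)).contMDiff.comp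
      ((hf.comp contMDiff_fst).prodMk_space (hf.comp contMDiff_snd))
  · refine contMDiff_of_unitaryEmb_comp e continuous_inv ?_
    have h : unitaryEmb e ∘ (fun g : G => g⁻¹) = fun g => star (unitaryEmb e g) := by
      ext1 g
      exact unitaryEmb_inv e g
    rw [h]
    exact (starL' ℝ : A ≃L[ℝ] A).contDiff.contMDiff.comp hf

theorem hasMFDerivAt_unitaryEmb_one :
    letI := cayleyChartedSpace e
    HasMFDerivAt 𝓘(ℝ, SkewSpace A) 𝓘(ℝ, A) (unitaryEmb e) 1
      ((2 : ℝ) • (skewAdjoint.submodule ℝ A).subtypeL) := by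
  let := cayleyChartedSpace e
  refine ⟨(continuous_unitaryEmb e).continuousAt, ?_⟩
  have h1 : extChartAt 𝓘(ℝ, SkewSpace A) (1 : G) 1 = 0 := by
    change cayleyChart e 1 1 = 0
    rw [cayleyChart_apply, ← unitaryEmb_mul, inv_one, mul_one, unitaryEmb_one, cayley_one]
  rw [h1]
  refine HasFDerivAt.hasFDerivWithinAt ?_
  have hf : writtenInExtChartAt 𝓘(ℝ, SkewSpace A) 𝓘(ℝ, A) (1 : G) (unitaryEmb e)
      = invCayley := by
    ext1 y
    change unitaryEmb e ((cayleyChart e 1).symm y) = _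
    rw [unitaryEmb_cayleyChart_symm, unitaryEmb_one, one_mul]
  rw [hf]
  exact hasFDerivAt_invCayley_zero

theorem isBanachLieGroup_of_equiv_unitary {A G : Type u} [CStarAlgebra A] [Group G]
    [TopologicalSpace G] [IsTopologicalGroup G] (e : G ≃ₜ* unitary A) : IsBanachLieGroup G :=
  ⟨SkewSpace A, inferInstance, inferInstance, inferInstance, cayleyChartedSpace e,
    lieGroup_cayley e⟩

end UnitaryLieGroup

/-! ### The tangent space inside the bounded operators -/

section TangentSpace

variable {H : Type u} [NormedAddCommGroup H] [InnerProductSpace ℂ H] [CompleteSpace H]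

theorem hasTangentLieAlgebra_of_equiv_unitary {A : Type u} [CStarAlgebra A]
    {S : Subgroup (unitary (H →L[ℂ] H))} (e : S ≃ₜ* unitary A) (j : A →L[ℝ] (H →L[ℂ] H))
    (hj : Function.Injective j)
    (hje : ∀ u : S, j (e u) = ((u : unitary (H →L[ℂ] H)) : H →L[ℂ] H)) :
    HasTangentLieAlgebra S (j '' {x | star x = -x}) := by
  let := cayleyChartedSpace e
  have hfun : (fun u : S => ((u : unitary (H →L[ℂ] H)) : H →L[ℂ] H)) = j ∘ unitaryEmb e := by
    ext1 u
    exact (hje u).symm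
  have hd : HasMFDerivAt 𝓘(ℝ, SkewSpace A) 𝓘(ℝ, H →L[ℂ] H) (j ∘ unitaryEmb e) 1
      (j.comp ((2 : ℝ) • (skewAdjoint.submodule ℝ A).subtypeL)) :=
    j.hasMFDerivAt.comp 1 (hasMFDerivAt_unitaryEmb_one e)
  refine ⟨SkewSpace A, inferInstance, inferInstance, inferInstance, cayleyChartedSpace e,
    lieGroup_cayley e, ?_, ?_, ?_⟩
  · rw [hfun]
    exact j.contDiff.contMDiff.comp (contMDiff_unitaryEmb e)
  · rw [hfun, hd.mfderiv]
    intro x y hxy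
    have h := hj hxy
    exact Subtype.ext (smul_right_injective A (two_ne_zero (α := ℝ)) h)
  · rw [hfun, hd.mfderiv]
    ext T
    constructor
    · rintro ⟨x, rfl⟩
      have h : ∀ y : SkewSpace A, j ((2 : ℝ) • (y : A)) ∈ j '' {x | star x = -x} :=
        fun y => ⟨_, ((2 : ℝ) • y).2, rfl⟩
      exact h x
    · rintro ⟨x, hx, rfl⟩
      -- The half cancels the factor 2 in the derivative of `invCayley` at 0.
      refine ⟨((2⁻¹ : ℝ) • (⟨x, hx⟩ : SkewSpace A) : SkewSpace A), ?_⟩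
      change j ((2 : ℝ) • ((2⁻¹ : ℝ) • x)) = j x
      rw [smul_smul]
      norm_num

end TangentSpace

/-! ### Adjoints of compact operators -/

section CompactAdjoint

open Metric

variable {H : Type u} [NormedAddCommGroup H] [InnerProductSpace ℂ H] [CompleteSpace H]

/-- Schauder's theorem through `‖T* z‖² = ⟪z, T T* z⟫ ≤ ‖z‖ ‖T T* z‖`: a finite net for the image of
the unit ball under the compact operator `T T*` yields one for `T*`. -/
theorem IsCompactOperator.star_clm {T : H →L[ℂ] H} (hT : IsCompactOperator T) :
    IsCompactOperator (star T : H →L[ℂ] H) := by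
  rw [isCompactOperator_iff_exists_mem_nhds_isCompact_closure_image]
  refine ⟨ball 0 1, ball_mem_nhds 0 one_pos,
    (TotallyBounded.closure ?_).isCompact_of_isClosed isClosed_closure⟩
  have hS : IsCompactOperator (T * star T) := hT.mul_right_clm _
  have hSt : TotallyBounded ((T * star T) '' ball 0 1) :=
    (hS.isCompact_closure_image_ball 1).totallyBounded.subset subset_closure
  rw [Metric.totallyBounded_iff]
  intro ε hε
  -- Centres inside the ball give `‖x - y‖ ≤ 2`, so the mesh `ε² / 2` bounds the square by `ε²`.
  obtain ⟨t, hts, htf, htc⟩ := Set.exists_subset_image_finite_and.mp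
    (finite_approx_of_totallyBounded hSt (ε ^ 2 / 2) (by positivity))
  refine ⟨(star T : H →L[ℂ] H) '' t, htf.image _, ?_⟩
  rintro _ ⟨x, hx, rfl⟩
  have hx' := htc ⟨x, hx, rfl⟩
  simp only [Set.mem_iUnion, Set.mem_image, exists_prop, exists_exists_and_eq_and] at hx' ⊢
  obtain ⟨y, hy, hxy⟩ := hx'
  refine ⟨y, hy, ?_⟩
  rw [mem_ball, dist_eq_norm, ← map_sub] at hxy ⊢
  have hz : ‖x - y‖ ≤ 2 := by
    have h1 := mem_ball_zero_iff.mp hx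
    have h2 := mem_ball_zero_iff.mp (hts hy)
    linarith [norm_sub_le x y]
  have h : ‖star T (x - y)‖ ^ 2 ≤ ‖x - y‖ * ‖(T * star T) (x - y)‖ := by
    rw [← inner_self_eq_norm_sq (𝕜 := ℂ), ContinuousLinearMap.star_eq_adjoint,
      ContinuousLinearMap.adjoint_inner_left]
    exact (Complex.re_le_norm _).trans (norm_inner_le_norm _ _)
  refine lt_of_pow_lt_pow_left₀ 2 hε.le ?_
  nlinarith [norm_nonneg ((T * star T) (x - y))]

end CompactAdjoint

/-! ### Diagonal operators and their compactness -/

section DiagonalOperators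

open Filter Topology ENNReal

variable {H : Type u} [NormedAddCommGroup H] [InnerProductSpace ℂ H] {ι : Type v}

theorem HilbertBasis.clm_ext (b : HilbertBasis ι ℂ H) {S T : H →L[ℂ] H}
    (h : ∀ i, S (b i) = T (b i)) : S = T := by
  refine ContinuousLinearMap.ext_on (s := Set.range b) ?_ ?_
  · rw [Submodule.dense_iff_topologicalClosure_eq_top]
    exact b.dense_span
  · rintro _ ⟨i, rfl⟩
    exact h i

theorem memℓp_mul_repr (d : lp (fun _ : ι => ℂ) ∞) (x : lp (fun _ : ι => ℂ) 2) :
    Memℓp (fun i => d i * x i) 2 := by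
  refine ((lp.memℓp x).const_mul (‖d‖ : ℂ)).mono' fun i => ?_
  rw [norm_mul, norm_mul, Complex.norm_real, norm_norm]
  gcongr
  exact lp.norm_apply_le_norm ENNReal.top_ne_zero d i

/-- The diagonal operator with a given bounded family of eigenvalues. -/
def diagOp (b : HilbertBasis ι ℂ H) : lp (fun _ : ι => ℂ) ∞ →L[ℂ] H →L[ℂ] H :=
  LinearMap.mkContinuous₂
    (LinearMap.mk₂ ℂ (fun d x => b.repr.symm ⟨fun i => d i * b.repr x i, memℓp_mul_repr d _⟩)
      (fun d d' x => by
        apply b.repr.injective; ext i; simp [add_mul]; rfl)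
      (fun c d x => by
        apply b.repr.injective; ext i; simp [mul_assoc])
      (fun d x y => by
        apply b.repr.injective; ext i; simp [mul_add]; rfl)
      (fun c d x => by
        apply b.repr.injective; ext i; simp [mul_left_comm])) 1 fun d x => by
    rw [LinearMap.mk₂_apply, LinearIsometryEquiv.norm_map, one_mul, ← b.repr.norm_map x,
      ← norm_norm d, ← Complex.norm_real, ← norm_smul]
    refine lp.norm_mono two_ne_zero fun i => ?_
    rw [lp.coeFn_smul, Pi.smul_apply, norm_smul, norm_mul, Complex.norm_real, norm_norm]
    gcongr
    exact lp.norm_apply_le_norm ENNReal.top_ne_zero d i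

theorem repr_diagOp (b : HilbertBasis ι ℂ H) (d : lp (fun _ : ι => ℂ) ∞) (x : H) (i : ι) :
    b.repr (diagOp b d x) i = d i * b.repr x i := by
  simp [diagOp]

theorem diagOp_apply_basis (b : HilbertBasis ι ℂ H) (d : lp (fun _ : ι => ℂ) ∞) (i : ι) :
    diagOp b d (b i) = d i • b i := by
  classical
  apply b.repr.injective
  ext j
  rw [repr_diagOp, map_smul, lp.coeFn_smul, Pi.smul_apply, b.repr_self, lp.single_apply,
    smul_eq_mul]
  by_cases h : j = i
  · subst h; simp
  · simp [h]

theorem isDiagonalOp_of_apply_basis {b : HilbertBasis ι ℂ H} {T : H →L[ℂ] H} {c : ι → ℂ}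
    (h : ∀ i, T (b i) = c i • b i) : IsDiagonalOp b T := by
  intro i j hij
  rw [h, inner_smul_left, b.orthonormal.2 hij, mul_zero]

theorem isDiagonalOp_diagOp (b : HilbertBasis ι ℂ H) (d : lp (fun _ : ι => ℂ) ∞) :
    IsDiagonalOp b (diagOp b d) :=
  isDiagonalOp_of_apply_basis (diagOp_apply_basis b d)

/-- The family of diagonal matrix coefficients of an operator. -/
def diagCoeff (b : HilbertBasis ι ℂ H) : (H →L[ℂ] H) →L[ℂ] lp (fun _ : ι => ℂ) ∞ :=
  have hb : ∀ (T : H →L[ℂ] H) i, ‖inner ℂ (b i) (T (b i))‖ ≤ ‖T‖ := fun T i => by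
    refine (norm_inner_le_norm _ _).trans ?_
    rw [b.orthonormal.1 i, one_mul]
    simpa [b.orthonormal.1 i] using T.le_opNorm (b i)
  LinearMap.mkContinuous
    { toFun := fun T => ⟨fun i => inner ℂ (b i) (T (b i)),
        memℓp_infty ⟨‖T‖, by rintro _ ⟨i, rfl⟩; exact hb T i⟩⟩
      map_add' := fun S T => by ext i; simp; rfl
      map_smul' := fun c T => by ext i; simp } 1 fun T => by
    rw [one_mul]
    exact lp.norm_le_of_forall_le (norm_nonneg _) (hb T)

theorem diagCoeff_apply (b : HilbertBasis ι ℂ H) (T : H →L[ℂ] H) (i : ι) :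
    diagCoeff b T i = inner ℂ (b i) (T (b i)) := rfl

theorem IsDiagonalOp.apply_basis_eq {b : HilbertBasis ι ℂ H} {T : H →L[ℂ] H}
    (hT : IsDiagonalOp b T) (i : ι) : T (b i) = diagCoeff b T i • b i := by
  obtain ⟨c, hc⟩ := hT.apply_basis i
  rw [diagCoeff_apply, hc, inner_smul_right, inner_self_eq_norm_sq_to_K, b.orthonormal.1 i]
  simp

theorem IsDiagonalOp.diagOp_diagCoeff {b : HilbertBasis ι ℂ H} {T : H →L[ℂ] H}
    (hT : IsDiagonalOp b T) : diagOp b (diagCoeff b T) = T :=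
  b.clm_ext fun i => by rw [diagOp_apply_basis, hT.apply_basis_eq]

theorem isDiagonalOp_one (b : HilbertBasis ι ℂ H) : IsDiagonalOp b 1 :=
  isDiagonalOp_of_apply_basis (c := fun _ => 1) fun i => by simp

theorem IsDiagonalOp.mul {b : HilbertBasis ι ℂ H} {S T : H →L[ℂ] H}
    (hS : IsDiagonalOp b S) (hT : IsDiagonalOp b T) : IsDiagonalOp b (S * T) :=
  isDiagonalOp_of_apply_basis (c := fun i => diagCoeff b T i * diagCoeff b S i) fun i => by
    rw [mul_apply_eq_comp, hT.apply_basis_eq, map_smul, hS.apply_basis_eq, smul_smul]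

theorem IsDiagonalOp.smul {b : HilbertBasis ι ℂ H} {T : H →L[ℂ] H} (c : ℂ)
    (hT : IsDiagonalOp b T) : IsDiagonalOp b (c • T) := by
  intro i j h
  simp [hT i j h]

theorem isCompactOperator_diagOp_single [DecidableEq ι] (b : HilbertBasis ι ℂ H) (i : ι) (c : ℂ) :
    IsCompactOperator (diagOp b (lp.single ∞ i c)) := by
  have h : diagOp b (lp.single ∞ i c)
      = (ContinuousLinearMap.toSpanSingleton ℂ (c • b i)).comp (innerSL ℂ (b i)) := by
    refine b.clm_ext fun j => ?_
    rw [diagOp_apply_basis, lp.single_apply]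
    by_cases hij : j = i
    · subst hij
      simp [b.orthonormal.1 j]
    · simp [hij, b.orthonormal.2 (Ne.symm hij)]
  rw [h]
  exact ((isCompactOperator_id (E := ℂ)).comp_clm (innerSL ℂ (b i))).clm_comp
    (ContinuousLinearMap.toSpanSingleton ℂ (c • b i))

/-- Beyond the finite set where `‖d i‖ ≥ ε / 2`, the remainder has sup norm at most `ε / 2`. -/
theorem hasSum_lp_single_of_tendsto_zero [DecidableEq ι] {d : lp (fun _ : ι => ℂ) ∞}
    (hd : Tendsto (fun i => d i) cofinite (𝓝 0)) :
    HasSum (fun i => lp.single (E := fun _ : ι => ℂ) ∞ i (d i)) d := by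
  rw [HasSum, SummationFilter.unconditional_filter, Metric.tendsto_atTop]
  intro ε hε
  have h := hd.eventually (Metric.ball_mem_nhds (0 : ℂ) (half_pos hε))
  rw [eventually_cofinite] at h
  refine ⟨h.toFinset, fun s hs => ?_⟩
  rw [dist_comm, dist_eq_norm]
  refine lt_of_le_of_lt (lp.norm_le_of_forall_le (half_pos hε).le fun j => ?_) (half_lt_self hε)
  rw [lp.coeFn_sub, Pi.sub_apply, lp.coeFn_sum, Finset.sum_apply]
  simp only [lp.single_apply]
  by_cases hj : j ∈ s
  · rw [Finset.sum_eq_single j (by intro k _ hk; simp [hk.symm]) (fun h => absurd hj h)]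
    simpa using (half_pos hε).le
  · rw [Finset.sum_eq_zero (by intro k hk; simp [show j ≠ k from fun h => hj (h ▸ hk)])]
    have : j ∉ h.toFinset := fun h' => hj (hs h')
    simp at this
    simpa using this.le

/-- Such an operator is a norm limit of finite sums of rank-at-most-one diagonal operators. -/
theorem isCompactOperator_diagOp [CompleteSpace H] (b : HilbertBasis ι ℂ H)
    {d : lp (fun _ : ι => ℂ) ∞}
    (hd : Tendsto (fun i => d i) cofinite (𝓝 0)) : IsCompactOperator (diagOp b d) := by
  classical
  refine isCompactOperator_of_tendsto ((hasSum_lp_single_of_tendsto_zero hd).mapL (diagOp b)) ?_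
  refine Eventually.of_forall fun s => ?_
  exact Submodule.sum_mem (compactOperator (RingHom.id ℂ) H H)
    fun i _ => isCompactOperator_diagOp_single b i (d i)

/-- Along any ultrafilter finer than `cofinite`, compactness gives a limit `y` of `T (b i)`. Then
`⟪b i, T (b i) - y⟫` tends to 0 by Cauchy–Schwarz, and `⟪b i, y⟫` by Bessel's inequality. -/
theorem IsCompactOperator.tendsto_diagCoeff (b : HilbertBasis ι ℂ H) {T : H →L[ℂ] H}
    (hT : IsCompactOperator T) : Tendsto (fun i => diagCoeff b T i) cofinite (𝓝 0) := by
  obtain ⟨K, hK, hTK⟩ := hT.image_closedBall_subset_compact (f := (T : H →ₗ[ℂ] H)) 1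
  rw [tendsto_iff_ultrafilter]
  intro g hg
  have hgK : (g.map fun i => T (b i) : Filter H) ≤ 𝓟 K := by
    rw [le_principal_iff]
    refine Filter.mem_map.mpr (Filter.univ_mem' fun i => hTK ⟨b i, ?_, rfl⟩)
    simp [b.orthonormal.1 i]
  obtain ⟨y, -, hy⟩ := hK.ultrafilter_le_nhds _ hgK
  have h1 : Tendsto (fun i => T (b i) - y) g (𝓝 0) := by
    rw [← sub_self y]
    exact Tendsto.sub_const hy y
  have h2 : Tendsto (fun i => inner ℂ (b i) y) g (𝓝 0) := by
    have h := (b.orthonormal.inner_products_summable y).tendsto_cofinite_zero.mono_left hg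
    rw [tendsto_zero_iff_norm_tendsto_zero]
    simpa using h.sqrt
  have h3 : Tendsto (fun i => inner ℂ (b i) (T (b i) - y)) g (𝓝 0) := by
    refine squeeze_zero_norm (fun i => ?_) (tendsto_zero_iff_norm_tendsto_zero.mp h1)
    refine (norm_inner_le_norm _ _).trans ?_
    rw [b.orthonormal.1 i, one_mul]
  have h4 := h3.add h2
  rw [add_zero] at h4
  refine h4.congr fun i => ?_
  rw [← inner_add_right, sub_add_cancel, diagCoeff_apply]

variable [CompleteSpace H]

theorem IsDiagonalOp.star {b : HilbertBasis ι ℂ H} {T : H →L[ℂ] H}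
    (hT : IsDiagonalOp b T) : IsDiagonalOp b (star T) := by
  intro i j h
  rw [ContinuousLinearMap.star_eq_adjoint, ContinuousLinearMap.adjoint_inner_left,
    ← inner_conj_symm, hT j i h.symm, map_zero]

theorem IsDiagonalOp.isCompactOperator_iff {b : HilbertBasis ι ℂ H} {T : H →L[ℂ] H}
    (hT : IsDiagonalOp b T) :
    IsCompactOperator T ↔ Tendsto (fun i => diagCoeff b T i) cofinite (𝓝 0) := by
  refine ⟨fun h => h.tendsto_diagCoeff b, fun h => ?_⟩
  rw [← hT.diagOp_diagCoeff]
  exact isCompactOperator_diagOp b h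

theorem exp_apply_of_apply_eq_smul {T : H →L[ℂ] H} {x : H} {c : ℂ} (h : T x = c • x) :
    NormedSpace.exp T x = Complex.exp c • x := by
  have hpow : ∀ n : ℕ, (T ^ n) x = c ^ n • x := by
    intro n
    induction n with
    | zero => simp
    | succ n ih => rw [pow_succ', mul_apply_eq_comp, ih, map_smul, h, smul_smul, pow_succ]
  have h1 := (NormedSpace.exp_series_hasSum_exp' (𝕂 := ℂ) T).mapL (ContinuousLinearMap.apply ℂ H x)
  have h2 := (NormedSpace.exp_series_hasSum_exp' (𝕂 := ℂ) c).smul_const x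
  rw [Complex.exp_eq_exp_ℂ]
  refine h1.unique (h2.congr_fun fun n => ?_)
  simp [hpow, smul_smul]

theorem IsDiagonalOp.exp {b : HilbertBasis ι ℂ H} {T : H →L[ℂ] H}
    (hT : IsDiagonalOp b T) : IsDiagonalOp b (NormedSpace.exp T) :=
  isDiagonalOp_of_apply_basis fun i => exp_apply_of_apply_eq_smul (hT.apply_basis_eq i)

end DiagonalOperators

/-! ### The algebra of compact plus diagonal operators and its unitary group -/

section DiagonalPlusCompactAlgebra

open Filter Topology ENNReal

variable {H : Type u} [NormedAddCommGroup H] [InnerProductSpace ℂ H] [CompleteSpace H]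
  {ι : Type v} (b : HilbertBasis ι ℂ H)

/-- The C⋆-algebra of sums of a compact operator and a diagonal operator. -/
def diagCompact : StarSubalgebra ℂ (H →L[ℂ] H) where
  carrier := {T | ∃ K D : H →L[ℂ] H, IsCompactOperator K ∧ IsDiagonalOp b D ∧ T = K + D}
  mul_mem' := by
    rintro _ _ ⟨K, D, hK, hD, rfl⟩ ⟨K', D', hK', hD', rfl⟩
    refine ⟨K * (K' + D') + D * K', D * D',
      (hK.mul_right_clm _).add (hK'.mul_left_clm _), hD.mul hD', ?_⟩
    noncomm_ring
  add_mem' := by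
    rintro _ _ ⟨K, D, hK, hD, rfl⟩ ⟨K', D', hK', hD', rfl⟩
    exact ⟨K + K', D + D', hK.add hK', hD.add hD', by abel⟩
  algebraMap_mem' c := by
    refine ⟨0, c • 1, isCompactOperator_zero, (isDiagonalOp_one b).smul c, ?_⟩
    rw [zero_add, Algebra.algebraMap_eq_smul_one]
  star_mem' := by
    rintro _ ⟨K, D, hK, hD, rfl⟩
    exact ⟨star K, star D, hK.star_clm, hD.star, star_add K D⟩

variable {b}

/-- Taking the diagonal part fixes diagonal operators and preserves compactness, so the existential
over decompositions becomes a closed condition on `T` alone. -/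
theorem mem_diagCompact_iff_isCompactOperator_sub {T : H →L[ℂ] H} :
    T ∈ diagCompact b ↔ IsCompactOperator (T - diagOp b (diagCoeff b T)) := by
  constructor
  · rintro ⟨K, D, hK, hD, rfl⟩
    have h : K + D - diagOp b (diagCoeff b (K + D)) = K - diagOp b (diagCoeff b K) := by
      rw [map_add, map_add, hD.diagOp_diagCoeff]
      abel
    rw [h]
    exact hK.sub (isCompactOperator_diagOp b (hK.tendsto_diagCoeff b))
  · intro h
    exact ⟨_, _, h, isDiagonalOp_diagOp b _, (sub_add_cancel _ _).symm⟩

theorem isClosed_diagCompact : IsClosed (diagCompact b : Set (H →L[ℂ] H)) := by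
  have h : (diagCompact b : Set (H →L[ℂ] H))
      = (fun T => T - diagOp b (diagCoeff b T)) ⁻¹' {T | IsCompactOperator T} := by
    ext T
    exact mem_diagCompact_iff_isCompactOperator_sub
  rw [h]
  exact isClosed_setOfPred_isCompactOperator.preimage
    (continuous_id.sub ((diagOp b).continuous.comp (diagCoeff b).continuous))

theorem mem_lieAlgebraKD_iff {X : H →L[ℂ] H} :
    X ∈ lieAlgebraKD b ↔ X ∈ diagCompact b ∧ star X = -X := by
  constructor
  · rintro ⟨K, D, ⟨hK, hKs⟩, ⟨hD, hDs⟩, rfl⟩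
    exact ⟨⟨K, D, hK, hD, rfl⟩, by rw [star_add, hKs, hDs]; abel⟩
  · rintro ⟨⟨K, D, hK, hD, rfl⟩, hs⟩
    -- A given decomposition need not have skew summands; their skew parts still add up to `X`.
    refine ⟨(2⁻¹ : ℝ) • (K - star K), (2⁻¹ : ℝ) • (D - star D), ⟨(hK.sub hK.star_clm).smul _, ?_⟩,
      ⟨?_, ?_⟩, ?_⟩
    · rw [star_smul, star_sub, star_star, star_trivial, ← smul_neg, neg_sub]
    · rw [sub_eq_add_neg]
      exact (hD.add hD.star.neg).real_smul _
    · rw [star_smul, star_sub, star_star, star_trivial, ← smul_neg, neg_sub]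
    · have h : (K - star K) + (D - star D) = (2 : ℝ) • (K + D) := by
        have h1 : K + D = -(star K + star D) := by rw [← star_add, hs, neg_neg]
        calc (K - star K) + (D - star D) = (K + D) + -(star K + star D) := by abel
          _ = (2 : ℝ) • (K + D) := by rw [← h1, two_smul]
      rw [← smul_add, h, smul_smul]
      norm_num

/-- The exponent `D'` has eigenvalues `i arg d`. Then `D - e^{D'}` has eigenvalues `(|d| - 1) e^{i
arg d}`, dominated by `|d|² - 1`, which tends to 0. A vanishing `d` is harmless: the polar form
holds with `arg 0 = 0`. -/
theorem exists_skew_isCompactOperator_sub_exp {D : H →L[ℂ] H} (hD : IsDiagonalOp b D)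
    (h : IsCompactOperator (star D * D - 1 : H →L[ℂ] H)) :
    ∃ D' : H →L[ℂ] H, IsDiagonalOp b D' ∧ star D' = -D' ∧
      IsCompactOperator (D - NormedSpace.exp D') := by
  let d' : lp (fun _ : ι => ℂ) ∞ := ⟨fun i => (diagCoeff b D i).arg * Complex.I,
    memℓp_infty ⟨Real.pi, by
      rintro _ ⟨i, rfl⟩
      simpa using Complex.abs_arg_le_pi _⟩⟩
  have hd' : ∀ i, d' i = (diagCoeff b D i).arg * Complex.I := fun i => rfl
  have hD' := isDiagonalOp_diagOp b d'
  refine ⟨diagOp b d', hD', ?_, ?_⟩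
  · refine b.clm_ext fun i => ?_
    rw [hD'.star.apply_basis_eq, diagCoeff_apply, ContinuousLinearMap.star_eq_adjoint,
      ContinuousLinearMap.adjoint_inner_right, neg_apply, diagOp_apply_basis,
      inner_smul_left, inner_self_eq_norm_sq_to_K, b.orthonormal.1 i, hd']
    simp
  · have hS : IsDiagonalOp b (star D * D - 1) := by
      rw [sub_eq_add_neg]
      exact (hD.star.mul hD).add (isDiagonalOp_one b).neg
    have hE : IsDiagonalOp b (D - NormedSpace.exp (diagOp b d')) := by
      rw [sub_eq_add_neg]
      exact hD.add hD'.exp.neg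
    have h1 := hS.isCompactOperator_iff.mp h
    rw [hE.isCompactOperator_iff]
    refine squeeze_zero_norm (fun i => ?_) (tendsto_zero_iff_norm_tendsto_zero.mp h1)
    have hb : inner ℂ (b i) (b i) = (1 : ℂ) := by
      rw [inner_self_eq_norm_sq_to_K, b.orthonormal.1 i]; simp
    have e1 : diagCoeff b (star D * D - 1) i = ((‖diagCoeff b D i‖ ^ 2 - 1 : ℝ) : ℂ) := by
      rw [diagCoeff_apply, sub_apply, mul_apply_eq_comp, inner_sub_right,
        ContinuousLinearMap.star_eq_adjoint, ContinuousLinearMap.adjoint_inner_right,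
        hD.apply_basis_eq, inner_smul_left, inner_smul_right, one_apply_eq_self, hb,
        mul_one, Complex.conj_mul']
      push_cast
      rfl
    have e2 : diagCoeff b (D - NormedSpace.exp (diagOp b d')) i
        = ((‖diagCoeff b D i‖ - 1 : ℝ) : ℂ) * Complex.exp (d' i) := by
      rw [diagCoeff_apply, sub_apply, inner_sub_right, ← diagCoeff_apply,
        exp_apply_of_apply_eq_smul (diagOp_apply_basis b d' i), inner_smul_right, hb, mul_one, hd']
      nth_rewrite 1 [← Complex.norm_mul_exp_arg_mul_I (diagCoeff b D i)]
      push_cast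
      ring
    rw [e1, e2, norm_mul, hd', Complex.norm_exp_ofReal_mul_I, mul_one, Complex.norm_real,
      Complex.norm_real, Real.norm_eq_abs, Real.norm_eq_abs]
    have hn := norm_nonneg (diagCoeff b D i)
    rw [show ‖diagCoeff b D i‖ ^ 2 - 1 = (‖diagCoeff b D i‖ - 1) * (‖diagCoeff b D i‖ + 1) by ring,
      abs_mul, abs_of_nonneg (show 0 ≤ ‖diagCoeff b D i‖ + 1 by positivity)]
    exact le_mul_of_one_le_right (abs_nonneg _) (by linarith)

theorem mem_unitaryKD_iff {u : unitary (H →L[ℂ] H)} :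
    u ∈ unitaryKD b ↔ (u : H →L[ℂ] H) ∈ diagCompact b := by
  constructor
  · rintro ⟨D, hD, -, hc⟩
    exact ⟨_, _, hc, hD.exp, (sub_add_cancel _ _).symm⟩
  · rintro ⟨K, D, hK, hD, hu⟩
    -- Expand `1 = star u * u` with `u = K + D`: every term other than `star D * D` has a compact
    -- factor.
    have h : star D * D - 1 = -(star K * (K + D) + star D * K) := by
      have h1 := Unitary.coe_star_mul_self u
      rw [hu, star_add] at h1
      rw [← h1]
      noncomm_ring
    have hc : IsCompactOperator (star D * D - 1 : H →L[ℂ] H) := by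
      rw [h]
      exact ((hK.star_clm.mul_right_clm _).add (hK.mul_left_clm _)).neg
    obtain ⟨D', hD', hs, hc'⟩ := exists_skew_isCompactOperator_sub_exp hD hc
    refine ⟨D', hD', hs, ?_⟩
    rw [hu, add_sub_assoc]
    exact hK.add hc'

/-- Closedness makes the star subalgebra a C⋆-algebra, so that the Cayley atlas applies to it. -/
instance : IsClosed (diagCompact b : Set (H →L[ℂ] H)) := isClosed_diagCompact

/-- The group `U_{k,d}` is the unitary group of the C⋆-algebra of diagonal plus compact
operators. -/
def unitaryKDEquiv : unitaryKD b ≃ₜ* unitary (diagCompact b) where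
  toFun u := ⟨⟨((u : unitary (H →L[ℂ] H)) : H →L[ℂ] H), mem_unitaryKD_iff.mp u.2⟩,
    Unitary.mem_iff.mpr ⟨Subtype.ext (Unitary.coe_star_mul_self (u : unitary (H →L[ℂ] H))),
      Subtype.ext (Unitary.coe_mul_star_self (u : unitary (H →L[ℂ] H)))⟩⟩
  invFun w := ⟨⟨((w : diagCompact b) : H →L[ℂ] H),
    Unitary.mem_iff.mpr ⟨congrArg Subtype.val (Unitary.coe_star_mul_self w),
      congrArg Subtype.val (Unitary.coe_mul_star_self w)⟩⟩,
    mem_unitaryKD_iff.mpr (w : diagCompact b).2⟩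
  left_inv _ := rfl
  right_inv _ := rfl
  map_mul' _ _ := rfl
  continuous_toFun :=
    ((continuous_subtype_val.comp continuous_subtype_val).subtype_mk _).subtype_mk _
  continuous_invFun :=
    ((continuous_subtype_val.comp continuous_subtype_val).subtype_mk _).subtype_mk _

variable (b)

/-- The inclusion of the diagonal plus compact operators in the bounded operators. -/
def diagCompactInclusion : diagCompact b →L[ℝ] (H →L[ℂ] H) where
  toFun := Subtype.val
  map_add' _ _ := rfl
  map_smul' _ _ := rfl
  cont := continuous_subtype_val

theorem isLieSubgroup_unitaryKD : IsLieSubgroup (unitaryKD b) where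
  -- The full unitary group is the case where the C⋆-algebra is `H →L[ℂ] H` itself.
  ambient := isBanachLieGroup_of_equiv_unitary (ContinuousMulEquiv.refl _)
  isClosed := by
    have h : (unitaryKD b : Set (unitary (H →L[ℂ] H)))
        = Subtype.val ⁻¹' (diagCompact b : Set (H →L[ℂ] H)) := by
      ext u
      exact mem_unitaryKD_iff
    rw [h]
    exact isClosed_diagCompact.preimage continuous_subtype_val
  isBanachLieGroup := isBanachLieGroup_of_equiv_unitary unitaryKDEquiv

theorem hasTangentLieAlgebra_unitaryKD :
    HasTangentLieAlgebra (unitaryKD b) (lieAlgebraKD b : Set (H →L[ℂ] H)) := by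
  have h := hasTangentLieAlgebra_of_equiv_unitary (unitaryKDEquiv (b := b))
    (diagCompactInclusion b) Subtype.val_injective fun _ => rfl
  convert h using 1
  ext X
  rw [SetLike.mem_coe, mem_lieAlgebraKD_iff]
  constructor
  · rintro ⟨hX, hs⟩
    exact ⟨⟨X, hX⟩, Subtype.ext hs, rfl⟩
  · rintro ⟨X, hs, rfl⟩
    exact ⟨X.2, congrArg Subtype.val hs⟩

theorem oneParameterLieAlgebra_unitaryKD :
    oneParameterLieAlgebra (unitaryKD b) = (lieAlgebraKD b : Set (H →L[ℂ] H)) := by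
  ext X
  rw [SetLike.mem_coe, mem_lieAlgebraKD_iff]
  constructor
  · rintro ⟨hs, hX⟩
    refine ⟨?_, hs⟩
    have hmem : ∀ t : ℝ, NormedSpace.exp (t • X) ∈ diagCompact b := fun t => by
      obtain ⟨u, hu, hux⟩ := hX t
      rw [← hux]
      exact mem_unitaryKD_iff.mp hu
    have hd := hasDerivAt_exp_smul_const (𝕂 := ℝ) X (0 : ℝ)
    rw [zero_smul, NormedSpace.exp_zero, one_mul, hasDerivAt_iff_tendsto_slope_zero] at hd
    -- `X` is the limit of the difference quotients `t⁻¹ (e^{tX} - 1)`, all of which lie in the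
    -- closed subspace.
    refine isClosed_diagCompact.mem_of_tendsto hd (Eventually.of_forall fun t => ?_)
    have h : ∀ T ∈ diagCompact b, t⁻¹ • T ∈ diagCompact b := fun T hT =>
      (diagCompact b).smul_mem hT ((t⁻¹ : ℝ) : ℂ)
    exact h _ (sub_mem (hmem _) (hmem _))
  · rintro ⟨hX, hs⟩
    refine ⟨hs, fun t => ?_⟩
    have hst : star (t • X) = -(t • X) := by
      rw [star_smul, hs, star_trivial, smul_neg]
    have ht : t • X ∈ diagCompact b := (diagCompact b).smul_mem hX ((t : ℝ) : ℂ)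
    let +nondep : NormedAlgebra ℚ (H →L[ℂ] H) := .restrictScalars ℚ ℂ (H →L[ℂ] H)
    refine ⟨⟨_, NormedSpace.exp_mem_unitary_of_mem_skewAdjoint hst⟩, mem_unitaryKD_iff.mpr ?_, rfl⟩
    exact NormedSpace.exp_mem isClosed_diagCompact ht

end DiagonalPlusCompactAlgebra

end

theorem mainTheorem3 {H : Type u} [NormedAddCommGroup H] [InnerProductSpace ℂ H] [CompleteSpace H]
    {ι : Type v} [Countable ι] (b : HilbertBasis ι ℂ H) :
    IsLieSubgroup (unitaryKD b) ∧
    oneParameterLieAlgebra (unitaryKD b) = (lieAlgebraKD b : Set (H →L[ℂ] H)) ∧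
    HasTangentLieAlgebra (unitaryKD b) (lieAlgebraKD b : Set (H →L[ℂ] H)) :=
  ⟨isLieSubgroup_unitaryKD b, oneParameterLieAlgebra_unitaryKD b,
    hasTangentLieAlgebra_unitaryKD b⟩
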